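/- \textbf{Lemma (Privacy of the vote).} \emph{Setting.} There are $n$ participants, $m\ge 1$ candidates and $s$ repetitions. An arbitrary fixed set $C$ of participants is corrupt and is controlled by an active adversary with unbounded computing power and private coins; the others are honest, and honest participant $i$ has an input $x_i\in\{1,\dots,m\}$. All pairs of participants are connected by private authentic channels, and there is a simultaneous broadcast channel. \emph{Protocol.} Phase A: for each candidate $k=1,\dots,m$ and each $j=1,\dots,s$ there is one parity round. In it each participant $i$ sets $p_i=0$ if $x_i\ne k$, and otherwise $p_i=1$ with probability $1/n$ and $p_i=0$ with probability $1-1/n$. He chooses uniformly a string $r_i\in\{0,1\}^n$ whose Hamming weight has parity $p_i$, sends its $l$-th bit to participant $l$ (keeping the $i$-th bit), and stores the parity $z[k]_i^j$ of the bits that he received together with his own. All these random choices are independent. Phase B: all participants simultaneously broadcast all their $z[k]_i^j$; if a value is missing, the protocol aborts. Phase C: let $\sigma[k]=\frac1s\sum_{j=1}^s\bigoplus_{i=1}^n z[k]_i^j$ and $p_v=\frac12\bigl(1-(\frac{n-2}{n})^v\bigr)$. The number of votes $y[k]$ is the (least) integer $v\ge 0$ with $|\sigma[k]-p_v|<\frac1{2e^2n}$;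 the protocol aborts if for some $k$ there is none, or if $\sum_k y[k]\ne n$. \emph{Adversary.} In each round it chooses the private bits that corrupt participants send, after seeing the bits that honest participants sent to corrupt ones up to and including this round; it chooses the corrupt broadcasts of Phase B without seeing the honest ones. It may withhold any message. An honest participant from whom a private bit of a round is withheld broadcasts nothing for that round. The \emph{view} consists of the adversary's coins, all private bits exchanged between honest and corrupt participants, all values broadcast, and the result of the vote (the tally, or ``abort''). \emph{Claim.} For every such adversary the following hold. \begin{enumerate} \item There is a randomized simulator $S$, mapping a tally to a random view, such that for all inputs $(x_i)_{i\notin C}$ of the honest participants the view in the vote, including the executions that abort, has exactly the same distribution as $S(y)$, where $y[k]=|\{i : x_i=k\}|$ is the output of the ideal functionality when $x_i=1$ for every corrupt $i$. \item There is a randomized simulator $S'$ such that for every assignment of values to the flip bits $p_i$ of the honest participants in all rounds, the view given these flip bits has exactly the same distribution as the output of $S'$ on the list of the parities $\bigoplus_{i\notin C}p_i$, one for each round. \item The view determines the parity $\bigoplus_{i\notin C}p_i$ of each round in which the corrupt participants withhold no private bit from the honest participants. \end{enumerate} -/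

import Mathlib

open scoped ENNReal NNReal

namespace VoteProtocol

/-- Bits, with addition as exclusive or. -/
abbrev Bit : Type := ZMod 2

/-- The parity rounds of the vote: `(k, j)` is the `j`-th repetition for candidate `k`. -/
abbrev Round (m s : ℕ) : Type := Fin m × Fin s

/-- The participants controlled by the adversary. -/
abbrev Corrupt {n : ℕ} (C : Finset (Fin n)) : Type := {i : Fin n // i ∈ C}

/-- The participants not controlled by the adversary. -/
abbrev Honest {n : ℕ} (C : Finset (Fin n)) : Type := {i : Fin n // i ∉ C}

/-! ### The ideal functionality -/

/-- The ideal functionality: the number of votes for each candidate. -/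
def tally {n m : ℕ} (x : Fin n → Fin m) (k : Fin m) : ℕ :=
  (Finset.univ.filter fun i => x i = k).card

/-- The inputs in which honest participants keep theirs and every corrupt participant votes for
the first candidate.  Candidates are indexed by `Fin m`, so the first one is `0`. -/
def withFirst {n m : ℕ} [NeZero m] (C : Finset (Fin n)) (x : Honest C → Fin m) (i : Fin n) :
    Fin m :=
  if h : i ∈ C then 0 else x ⟨i, h⟩

/-! ### Randomness of the honest participants -/

/-- Independent sampling: coordinate `i` is drawn from `μ i`. -/
noncomputable def independent {ι α : Type} [Fintype ι] [DecidableEq ι] [Fintype α]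
    (μ : ι → PMF α) : PMF (ι → α) :=
  PMF.ofFintype (fun f => ∏ i, μ i (f i)) (by
    have h := Finset.prod_univ_sum (fun _ : ι => (Finset.univ : Finset α)) (fun i a => μ i a)
    rw [Fintype.piFinset_univ] at h
    rw [← h]
    refine Finset.prod_eq_one fun i _ => ?_
    rw [← tsum_fintype (L := .unconditional α)]
    exact (μ i).tsum_coe)

/-- A bit that is `1` with probability `1/n` and `0` otherwise. -/
noncomputable def biasedBit (n : ℕ) : PMF Bit :=
  PMF.ofFintype (fun b => if b = 1 then (((n : ℝ≥0)⁻¹ : ℝ≥0) : ℝ≥0∞)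
      else 1 - (((n : ℝ≥0)⁻¹ : ℝ≥0) : ℝ≥0∞)) (by
    have h : (((n : ℝ≥0)⁻¹ : ℝ≥0) : ℝ≥0∞) ≤ 1 := by exact_mod_cast Nat.cast_inv_le_one n
    have e : (Finset.univ : Finset Bit) = {0, 1} := by decide
    rw [e, Finset.sum_pair (by decide), if_neg (by decide), if_pos rfl]
    exact tsub_add_cancel_of_le h)

/-- The flip bits `p_i` of the honest participants in all the rounds. -/
abbrev Flips {n : ℕ} (m s : ℕ) (C : Finset (Fin n)) : Type := Round m s × Honest C → Bit

/-- Honest participants with input `k` flip with probability `1/n` in the rounds of candidate `k`;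
all other flip bits are `0`.  All choices are independent. -/
noncomputable def chooseFlips {n m : ℕ} (s : ℕ) (C : Finset (Fin n)) (x : Honest C → Fin m) :
    PMF (Flips m s C) :=
  independent fun a => if x a.2 = a.1.1 then biasedBit n else PMF.pure 0

/-- The `n`-bit strings whose Hamming weight has parity `b`. -/
def stringsOfParity (n : ℕ) (b : Bit) : Finset (Fin n → Bit) :=
  Finset.univ.filter fun r => ∑ j, r j = b

theorem stringsOfParity_nonempty {n : ℕ} (i : Fin n) (b : Bit) :
    (stringsOfParity n b).Nonempty :=
  ⟨Pi.single i b, by simp [stringsOfParity]⟩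

/-- The strings `r_i` selected by the honest participants in all the rounds: bit `j` of
`r (t, i)` is what `i` sends to `j` in round `t`. -/
abbrev Strings {n : ℕ} (m s : ℕ) (C : Finset (Fin n)) : Type :=
  Round m s × Honest C → Fin n → Bit

/-- The strings are independent, each uniform among those whose parity is the flip bit. -/
noncomputable def chooseStrings {n m s : ℕ} {C : Finset (Fin n)} (p : Flips m s C) :
    PMF (Strings m s C) :=
  independent fun a =>
    PMF.uniformOfFinset (stringsOfParity n (p a)) (stringsOfParity_nonempty a.2.1 (p a))

/-- The parity of the flip bits of the honest participants in round `t`. -/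
def honestParity {n m s : ℕ} {C : Finset (Fin n)} (p : Flips m s C) (t : Round m s) : Bit :=
  ∑ i : Honest C, p (t, i)

/-! ### The adversary -/

/-- Round `u` is executed no later than round `t` (candidate by candidate). -/
def Round.NotAfter {m s : ℕ} (u t : Round m s) : Prop :=
  u.1 < t.1 ∨ (u.1 = t.1 ∧ u.2 ≤ t.2)

/-- An active adversary controlling the set `C`, with private coins in `Tape` and no bound on its
computing power.  In each parity round it sees the bits that honest participants send to corrupt
ones before choosing what corrupt participants send; `none` stands for sending nothing.
The broadcast being simultaneous, `broadcast` sees none of the values broadcast by honest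
participants. -/
structure Adversary (n m s : ℕ) (C : Finset (Fin n)) (Tape : Type*) where
  /-- The distribution of the coins. -/
  coins : PMF Tape
  /-- The private messages of round `t`, from the coins and the bits received up to round `t`. -/
  send : Tape → (t : Round m s) →
    ({u : Round m s // u.NotAfter t} → Honest C → Corrupt C → Bit) →
    Corrupt C → Honest C → Option Bit
  /-- The simultaneous broadcast, from the coins and all the private bits received. -/
  broadcast : Tape → (Round m s → Honest C → Corrupt C → Bit) →
    Round m s → Corrupt C → Option Bit

/-! ### The outcome -/

/-- The probability that the parity is odd when `v` participants flip with probability `1/n`, that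
is `(1/2) ((n-2)/n)^v ((n/(n-2))^v - 1)`, written without dividing by `n - 2`. -/
noncomputable def oddProbability (n v : ℕ) : ℝ :=
  (1 - (((n : ℝ) - 2) / n) ^ v) / 2

/-- The observed frequency of odd parities for candidate `k`. -/
noncomputable def frequency {n m s : ℕ} (z : Round m s → Fin n → Bit) (k : Fin m) : ℝ :=
  (∑ j : Fin s, ((∑ i, z (k, j) i : Bit).val : ℝ)) / s

/-- `v` is an acceptable number of votes for candidate `k`. -/
def Accepts {n m s : ℕ} (z : Round m s → Fin n → Bit) (k : Fin m) (v : ℕ) : Prop :=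
  |frequency z k - oddProbability n v| < 1 / (2 * Real.exp 1 ^ 2 * n)

open Classical in
/-- The public outcome of the vote computed from everything that was broadcast; `none` means
abort.  The vote aborts if some value is missing, if some candidate has no acceptable number of
votes, or if the numbers of votes do not sum to `n`.  (Should several numbers be acceptable, the
least is taken.) -/
noncomputable def outcome {n m s : ℕ} (a : Round m s → Fin n → Option Bit) :
    Option (Fin m → ℕ) :=
  if ∀ t i, a t i ≠ none then
    let z : Round m s → Fin n → Bit := fun t i => (a t i).getD 0
    if h : ∀ k, ∃ v, Accepts z k v then
      let y : Fin m → ℕ := fun k => Nat.find (h k)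
      if ∑ k, y k = n then some y else none
    else none
  else none

/-! ### Executions -/

/-- What the adversary sees in an execution. -/
structure View (n m s : ℕ) (C : Finset (Fin n)) (Tape : Type*) where
  /-- Its coins. -/
  tape : Tape
  /-- The private bits sent by honest participants to corrupt ones. -/
  received : Round m s → Honest C → Corrupt C → Bit
  /-- The private messages sent by corrupt participants to honest ones. -/
  sent : Round m s → Corrupt C → Honest C → Option Bit
  /-- The values broadcast by all participants. -/
  announced : Round m s → Fin n → Option Bit
  /-- The result of the vote. -/
  result : Option (Fin m → ℕ)

open Classical in
/-- The bit `z_h` that honest participant `h` stores in a parity round: the parity of the bits from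
the honest participants (including itself) and from the corrupt ones.  If some corrupt participant
sent nothing to `h`, this bit is not defined, and `h` has nothing to broadcast for this round. -/
noncomputable def storedBit {n m s : ℕ} {C : Finset (Fin n)} (r : Strings m s C)
    (sent : Round m s → Corrupt C → Honest C → Option Bit) (t : Round m s) (h : Honest C) :
    Option Bit :=
  if ∀ c, sent t c h ≠ none then
    some (∑ i : Honest C, r (t, i) h + ∑ c : Corrupt C, (sent t c h).getD 0)
  else none

namespace Adversary

variable {n m s : ℕ} {C : Finset (Fin n)} {Tape : Type*}

/-- The execution of the vote determined by the coins `w` of the adversary and the strings `r` of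
the honest participants, as seen by the adversary. -/
noncomputable def view (A : Adversary n m s C Tape) (w : Tape) (r : Strings m s C) :
    View n m s C Tape :=
  let received : Round m s → Honest C → Corrupt C → Bit := fun t i c => r (t, i) c
  let sent : Round m s → Corrupt C → Honest C → Option Bit :=
    fun t => A.send w t fun u => received u.1
  let announced : Round m s → Fin n → Option Bit := fun t i =>
    if h : i ∈ C then A.broadcast w received t ⟨i, h⟩ else storedBit r sent t ⟨i, h⟩
  ⟨w, received, sent, announced, outcome announced⟩

/-- The distribution of the view when the honest participants use the flip bits `p`. -/
noncomputable def viewOfFlips (A : Adversary n m s C Tape) (p : Flips m s C) :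
    PMF (View n m s C Tape) :=
  A.coins.bind fun w => (chooseStrings p).map fun r => A.view w r

/-- The distribution of the view in the vote when the honest participants have inputs `x`. -/
noncomputable def realView (A : Adversary n m s C Tape) (x : Honest C → Fin m) :
    PMF (View n m s C Tape) :=
  (chooseFlips s C x).bind fun p => A.viewOfFlips p

end Adversary

end VoteProtocol

namespace VoteProtocol

/-! The adversary sees the honest strings only through the bits sent to corrupt participants and,
for each honest `g`, the sum of the bits that honest participants send to `g`. Fix an honest `h`,
and let every honest `i` add `d (t, i)` to its bit for `h`. This carries the strings drawn for flips
`p` to those drawn for `p + d`, and alters only the sum at `h`, by the honest parity of `d`. With `d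
= q - p` and equal honest parities nothing visible changes, so the law of the view depends only on
these parities (`Adversary.viewOfFlips_eq`). For inputs, the tally fixes the honest votes up to a
permutation of the honest participants; this permutes independent flip bits and keeps their
parities, so the law of the view is the same (`Adversary.realView_eq`). The simulators are the
resulting factorizations. Conversely, if nothing is withheld in a round, all bits sent by honest
participants can be summed from the view (`Adversary.parity_view`). -/

theorem map_equiv_apply {α β : Type*} (e : α ≃ β) (μ : PMF α) (b : β) :
    μ.map e b = μ (e.symm b) := by
  classical
  rw [PMF.map_apply, tsum_eq_single (e.symm b)]
  · simp
  · intro a ha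
    rw [if_neg]
    rintro rfl
    simp at ha

theorem independent_apply {ι α : Type} [Fintype ι] [DecidableEq ι] [Fintype α]
    (μ : ι → PMF α) (f : ι → α) : independent μ f = ∏ i, μ i (f i) := by
  rw [independent, PMF.ofFintype_apply]

/-- Applying a bijection in each coordinate to an independent family. -/
theorem independent_map_piCongrRight {ι α : Type} [Fintype ι] [DecidableEq ι] [Fintype α]
    (μ : ι → PMF α) (e : ι → α ≃ α) :
    (independent μ).map (Equiv.piCongrRight e) = independent fun i => (μ i).map (e i) := by
  ext f
  simp only [map_equiv_apply, independent_apply]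
  rfl

/-- Permuting the coordinates of an independent family. -/
theorem independent_map_comp {ι α : Type} [Fintype ι] [DecidableEq ι] [Fintype α]
    (μ : ι → PMF α) (σ : Equiv.Perm ι) :
    (independent μ).map (fun f => f ∘ σ) = independent (μ ∘ σ) := by
  ext f
  refine (map_equiv_apply (σ.symm.arrowCongr (Equiv.refl α)) _ f).trans ?_
  simp only [independent_apply]
  refine (Equiv.prod_comp σ _).symm.trans ?_
  simp [Equiv.arrowCongr]

theorem uniformOfFinset_map_equiv {α : Type*} (e : α ≃ α) {s t : Finset α} (hs : s.Nonempty)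
    (ht : t.Nonempty) (h : ∀ a, e a ∈ t ↔ a ∈ s) :
    (PMF.uniformOfFinset s hs).map e = PMF.uniformOfFinset t ht := by
  classical
  have hc : s.card = t.card := Finset.card_equiv e fun a => (h a).symm
  ext b
  have hb : e.symm b ∈ s ↔ b ∈ t := by rw [← h, e.apply_symm_apply]
  rw [map_equiv_apply, PMF.uniformOfFinset_apply, PMF.uniformOfFinset_apply]
  simp only [hb, hc]

/-! ### Dependence of the view on the honest parities only -/

/-- Adding `d t i` to the bit that `i` sends to `h` in round `t`. -/
noncomputable def shiftStrings {n m s : ℕ} {C : Finset (Fin n)} (h : Honest C)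
    (d : Flips m s C) : Strings m s C ≃ Strings m s C :=
  Equiv.piCongrRight fun a => Equiv.addRight (Pi.single h.1 (d a))

theorem shiftStrings_apply {n m s : ℕ} {C : Finset (Fin n)} (h : Honest C) (d : Flips m s C)
    (r : Strings m s C) (a : Round m s × Honest C) (j : Fin n) :
    shiftStrings h d r a j = r a j + (Pi.single h.1 (d a) : Fin n → Bit) j := rfl

/-- Changing one coordinate by `d a` is a bijection from the strings of parity `p a` onto those of
parity `p a + d a`, so uniform laws go to uniform laws. -/
theorem chooseStrings_map_shiftStrings {n m s : ℕ} {C : Finset (Fin n)} (h : Honest C)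
    (p d : Flips m s C) :
    (chooseStrings p).map (shiftStrings h d) = chooseStrings (p + d) := by
  rw [chooseStrings, shiftStrings, independent_map_piCongrRight, chooseStrings]
  congr 1
  funext a
  refine uniformOfFinset_map_equiv _ _ _ fun r => ?_
  simp [stringsOfParity, Finset.sum_add_distrib]

/-- The view depends only on the bits received by corrupt participants and, for each honest
participant, on the parity of the bits that it gets from the honest ones. -/
theorem Adversary.view_congr {n m s : ℕ} {C : Finset (Fin n)} {Tape : Type*}
    (A : Adversary n m s C Tape) (w : Tape) {r r' : Strings m s C}
    (hC : ∀ t i (c : Corrupt C), r (t, i) c = r' (t, i) c)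
    (hH : ∀ t (h : Honest C), ∑ i, r (t, i) h = ∑ i, r' (t, i) h) :
    A.view w r = A.view w r' := by
  have e : (fun t i (c : Corrupt C) => r (t, i) c) =
      fun t i (c : Corrupt C) => r' (t, i) c := by
    funext t i c
    exact hC t i c
  have es : ∀ sent, storedBit r sent = storedBit r' sent := by
    intro sent
    funext t h
    simp only [storedBit, hH]
  have e' : ∀ t : Round m s, (fun (u : {u : Round m s // u.NotAfter t}) i (c : Corrupt C) =>
      r (u.1, i) c) =
      fun (u : {u : Round m s // u.NotAfter t}) i (c : Corrupt C) => r' (u.1, i) c := by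
    intro t
    funext u i c
    exact hC u.1 i c
  simp only [Adversary.view, e, e', es]

/-- No corrupt participant receives a modified bit because `h` is honest, and in each round the
modifications cancel in the sum at `h`. -/
theorem Adversary.view_shiftStrings {n m s : ℕ} {C : Finset (Fin n)} {Tape : Type*}
    (A : Adversary n m s C Tape) (w : Tape) (h : Honest C) {d : Flips m s C}
    (hd : honestParity d = 0) (r : Strings m s C) :
    A.view w (shiftStrings h d r) = A.view w r := by
  refine A.view_congr w (fun t i c => ?_) fun t g => ?_
  · have : c.1 ≠ h.1 := fun e => h.2 (e ▸ c.2)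
    simp [shiftStrings_apply, this]
  · simp only [shiftStrings_apply, Finset.sum_add_distrib, add_eq_left]
    by_cases e : g.1 = h.1
    · simpa [e, honestParity] using congrFun hd t
    · simp [e]

theorem Adversary.viewOfFlips_eq {n m s : ℕ} {C : Finset (Fin n)} {Tape : Type*}
    (A : Adversary n m s C Tape) {p q : Flips m s C} (hpq : honestParity p = honestParity q) :
    A.viewOfFlips p = A.viewOfFlips q := by
  rcases isEmpty_or_nonempty (Honest C) with _ | ⟨⟨h⟩⟩
  -- Without honest participants there is no `h` to shift at, but also no flip bit.
  · rw [Subsingleton.elim p q]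
  · have hd : honestParity (q - p) = 0 := by
      funext t
      have := congrFun hpq t
      simp only [honestParity] at this
      simp [honestParity, Finset.sum_sub_distrib, this]
    have e := chooseStrings_map_shiftStrings h p (q - p)
    rw [add_sub_cancel] at e
    simp only [Adversary.viewOfFlips, ← e, PMF.map_comp]
    congr 1
    funext w
    congr 1
    funext r
    exact (A.view_shiftStrings w h hd r).symm

/-! ### Symmetry among the honest participants -/

theorem chooseFlips_map_perm {n m : ℕ} (s : ℕ) (C : Finset (Fin n)) (x : Honest C → Fin m)
    (σ : Equiv.Perm (Honest C)) :
    (chooseFlips s C x).map (fun p => p ∘ (Equiv.refl (Round m s)).prodCongr σ) =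
      chooseFlips s C (x ∘ σ) :=
  independent_map_comp _ _

theorem honestParity_comp_perm {n m s : ℕ} {C : Finset (Fin n)} (p : Flips m s C)
    (σ : Equiv.Perm (Honest C)) :
    honestParity (p ∘ (Equiv.refl (Round m s)).prodCongr σ) = honestParity p := by
  funext t
  exact Equiv.sum_comp σ fun i => p (t, i)

theorem Adversary.realView_comp_perm {n m s : ℕ} {C : Finset (Fin n)} {Tape : Type*}
    (A : Adversary n m s C Tape) (x : Honest C → Fin m) (σ : Equiv.Perm (Honest C)) :
    A.realView (x ∘ σ) = A.realView x := by
  rw [Adversary.realView, ← chooseFlips_map_perm, PMF.bind_map, Adversary.realView]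
  congr 1
  funext p
  exact A.viewOfFlips_eq (honestParity_comp_perm p σ)

/-- The corrupt contribution does not depend on `x`, so it cancels when two tallies are compared,
leaving the numbers of honest votes. -/
theorem tally_withFirst {n m : ℕ} [NeZero m] (C : Finset (Fin n)) (x : Honest C → Fin m)
    (k : Fin m) :
    tally (withFirst C x) k =
      Fintype.card {i : Honest C // x i = k} + if k = 0 then C.card else 0 := by
  rw [tally, Finset.card_filter, ← Finset.sum_add_sum_compl C, add_comm]
  congr 1
  · rw [Fintype.card_subtype, Finset.card_filter,
      Finset.sum_subtype (p := fun i => i ∉ C) Cᶜ (by simp)]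
    refine Finset.sum_congr rfl fun i _ => ?_
    simp [withFirst, i.2]
  · rw [Finset.sum_congr rfl (g := fun _ => if k = 0 then 1 else 0)]
    · split_ifs <;> simp
    · intro i hi
      simp [withFirst, hi, eq_comm]

/-- Functions whose fibers have the same cardinalities differ by a permutation. -/
theorem exists_perm_of_card_fiber_eq {α β : Type*} [Fintype α] [DecidableEq β] {x y : α → β}
    (h : ∀ k, Fintype.card {i // x i = k} = Fintype.card {i // y i = k}) :
    ∃ σ : Equiv.Perm α, x = y ∘ σ := by
  let e : ∀ k, {i // x i = k} ≃ {i // y i = k} := fun k => Fintype.equivOfCardEq (h k)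
  refine ⟨(Equiv.sigmaFiberEquiv x).symm.trans
    ((Equiv.sigmaCongrRight e).trans (Equiv.sigmaFiberEquiv y)), ?_⟩
  funext i
  -- The image of `i` lies in the fiber of `y` over `x i` by construction.
  exact (e (x i) ⟨i, rfl⟩).2.symm

theorem Adversary.realView_eq {n m s : ℕ} [NeZero m] {C : Finset (Fin n)} {Tape : Type*}
    (A : Adversary n m s C Tape) {x y : Honest C → Fin m}
    (h : tally (withFirst C x) = tally (withFirst C y)) : A.realView x = A.realView y := by
  obtain ⟨σ, rfl⟩ : ∃ σ : Equiv.Perm (Honest C), x = y ∘ σ := by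
    refine exists_perm_of_card_fiber_eq fun k => ?_
    have := congrFun h k
    rwa [tally_withFirst, tally_withFirst, add_left_inj] at this
  exact A.realView_comp_perm y σ

/-! ### Recovering the parities from the view -/

/-- The parity of a round as computed from the view: the sum of the honest broadcasts and of all
private bits exchanged between honest and corrupt participants. -/
def View.parity {n m s : ℕ} {C : Finset (Fin n)} {Tape : Type*} (v : View n m s C Tape)
    (t : Round m s) : Bit :=
  ∑ h : Honest C, ((v.announced t h).getD 0 - ∑ c : Corrupt C, (v.sent t c h).getD 0) +
    ∑ i : Honest C, ∑ c : Corrupt C, v.received t i c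

theorem sum_eq_of_mem_support_chooseStrings {n m s : ℕ} {C : Finset (Fin n)} {p : Flips m s C}
    {r : Strings m s C} (hr : r ∈ (chooseStrings p).support) (a : Round m s × Honest C) :
    ∑ j, r a j = p a := by
  rw [PMF.mem_support_iff, chooseStrings, independent_apply, Finset.prod_ne_zero_iff] at hr
  have := (PMF.mem_support_uniformOfFinset_iff _ _).1
    ((PMF.mem_support_iff _ _).2 (hr a (Finset.mem_univ a)))
  simpa [stringsOfParity] using this

/-- An honest broadcast minus the corrupt bits received is the sum of the bits from honest senders.
Adding the bits sent to corrupt participants counts every bit of every honest string once, and each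
string sums to its flip bit. -/
theorem Adversary.parity_view {n m s : ℕ} {C : Finset (Fin n)} {Tape : Type*}
    (A : Adversary n m s C Tape) (w : Tape) {p : Flips m s C} {r : Strings m s C}
    (hr : r ∈ (chooseStrings p).support) (t : Round m s)
    (ht : ∀ c h, (A.view w r).sent t c h ≠ none) :
    (A.view w r).parity t = honestParity p t := by
  have ha : ∀ h : Honest C, ((A.view w r).announced t h).getD 0 -
      ∑ c : Corrupt C, ((A.view w r).sent t c h).getD 0 = ∑ i : Honest C, r (t, i) h := by
    intro h
    have e : (A.view w r).announced t h = storedBit r (A.view w r).sent t h := dif_neg h.2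
    rw [e, storedBit, if_pos fun c => ht c h, Option.getD_some, add_sub_cancel_right]
  have hsplit : ∀ i : Honest C,
      p (t, i) = ∑ h : Honest C, r (t, i) h + ∑ c : Corrupt C, r (t, i) c := by
    intro i
    rw [← sum_eq_of_mem_support_chooseStrings hr, add_comm]
    convert (Fintype.sum_subtype_add_sum_subtype (· ∈ C) (r (t, i))).symm
  simp only [View.parity, ha, honestParity, hsplit, Finset.sum_add_distrib]
  rw [Finset.sum_comm]
  rfl

end VoteProtocol

/-- Privacy of the vote against an active static adversary controlling any set `C`.
(1) Its view, whether or not the vote aborts, is distributed as the output of a simulator that is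
given only the output of the ideal functionality with all corrupt inputs set to the first candidate.
(2) Whatever the flip bits of the honest participants, its view is distributed as the output of a
simulator that is given only the parity of these bits in each round.
(3) The view does reveal this parity in every round in which no private bit is withheld. -/
theorem mainTheorem2 (n m s : ℕ) [NeZero m] (C : Finset (Fin n)) {Tape : Type*}
    (A : VoteProtocol.Adversary n m s C Tape) :
    (∃ S : (Fin m → ℕ) → PMF (VoteProtocol.View n m s C Tape),
      ∀ x : VoteProtocol.Honest C → Fin m,
        A.realView x = S (VoteProtocol.tally (VoteProtocol.withFirst C x))) ∧
    (∃ S : (VoteProtocol.Round m s → VoteProtocol.Bit) → PMF (VoteProtocol.View n m s C Tape),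
      ∀ p : VoteProtocol.Flips m s C,
        A.viewOfFlips p = S (VoteProtocol.honestParity p)) ∧
    (∃ f : VoteProtocol.View n m s C Tape → VoteProtocol.Round m s → VoteProtocol.Bit,
      ∀ (p : VoteProtocol.Flips m s C), ∀ v ∈ (A.viewOfFlips p).support,
        ∀ t : VoteProtocol.Round m s, (∀ c h, v.sent t c h ≠ none) →
          f v t = VoteProtocol.honestParity p t) := by
  refine ⟨?_, ?_, VoteProtocol.View.parity, ?_⟩
  · have h : Function.FactorsThrough A.realView
        fun x => VoteProtocol.tally (VoteProtocol.withFirst C x) :=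
      fun _ _ hxy => A.realView_eq hxy
    -- Outside the attained tallies the simulator may output anything; the view for constant inputs
    -- serves as a default.
    exact ⟨Function.extend _ A.realView fun _ => A.realView fun _ => 0,
      fun x => (h.extend_apply _ x).symm⟩
  · have h : Function.FactorsThrough A.viewOfFlips VoteProtocol.honestParity :=
      fun _ _ hpq => A.viewOfFlips_eq hpq
    exact ⟨Function.extend _ A.viewOfFlips fun _ => A.viewOfFlips 0,
      fun p => (h.extend_apply _ p).symm⟩
  · intro p v hv t ht
    rw [VoteProtocol.Adversary.viewOfFlips, PMF.mem_support_bind_iff] at hv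
    obtain ⟨w, -, hv⟩ := hv
    rw [PMF.mem_support_map_iff] at hv
    obtain ⟨r, hr, rfl⟩ := hv
    exact A.parity_view w hr t ht
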